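/- Fix a relational schema and an integer $k\ge 1$. Consider formulas of unary-negation fixpoint logic (UNFP), generated by $$\phi ::= R(\bar x)\mid X(x)\mid x=y\mid \phi\wedge\phi\mid\phi\vee\phi\mid\exists x\,\phi\mid\neg\phi(x)\mid[\mathrm{LFP}_{X,x}\,\phi](y),$$ where $X$ ranges over unary fixpoint variables, negation is applied only to formulas with at most one free first-order variable, and in $[\mathrm{LFP}_{X,x}\,\phi](y)$ the variable $X$ occurs only positively in $\phi$ and $\phi$ has no free first-order variable besides possibly $x$. A formula is in UN-normal form if, in its syntax tree, every existential quantifier other than the root is either directly below another existential quantifier or starts a subformula with at most one free first-order variable. A formula has width $k$ if, by rewriting subformulas with the rules $\phi\wedge\exists x\psi\to\exists x(\phi\wedge\psi)$ and $\phi\vee\exists x\psi\to\exists x(\phi\vee\psi)$ ($x$ not free in $\phi$; likewise with the two sides of $\wedge$, $\vee$ exchanged) and by safely renaming bound first-order variables, it can be brought into a formula in UN-normal form that uses at most $k$ first-order variables (free or bound). **Theorem.** Every satisfiable UNFP formula of width $k$ has a model of tree-width at most $k-1$. That is, if the formula is true in some nonempty structure under some interpretation of its free variables, then it is true, under some interpretation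 of its free variables, in a nonempty structure $M$ that has a tree decomposition with all bags of size at most $k$: a (possibly infinite) tree whose nodes $t$ carry sets $B_t\subseteq\mathrm{dom}(M)$ such that every fact of $M$ has all its elements in a common $B_t$ and, for every $a\in\mathrm{dom}(M)$, the set of nodes $t$ with $a\in B_t$ is nonempty and connected in the tree. -/

import Mathlib

universe u v w

namespace UNFP

/-- Formulas of monadic least fixpoint logic over the relational schema `L`, built from relational
atoms, fixpoint-variable atoms `X(x)`, equalities, `∧`, `∨`, `∃`, `¬` and
`[LFP_{X,x} φ](y)`. First-order variables and unary fixpoint variables are both named by natural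
numbers. The side conditions that define the unary-negation fragment are in `Formula.IsUNFP`. -/
inductive Formula (L : FirstOrder.Language.{u, v}) : Type v
  /-- the atom `R(x₁, …, xₙ)` -/
  | rel {n : ℕ} (R : L.Relations n) (x : Fin n → ℕ) : Formula L
  /-- the atom `X(x)` for a fixpoint variable `X` -/
  | fixvar (X : ℕ) (x : ℕ) : Formula L
  /-- the equality `x = y` -/
  | eq (x y : ℕ) : Formula L
  | and (φ ψ : Formula L) : Formula L
  | or (φ ψ : Formula L) : Formula L
  /-- the formula `∃ x φ` -/
  | ex (x : ℕ) (φ : Formula L) : Formula L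
  | neg (φ : Formula L) : Formula L
  /-- the formula `[LFP_{X,x} φ](y)` -/
  | lfp (X x : ℕ) (φ : Formula L) (y : ℕ) : Formula L

namespace Formula

variable {L : FirstOrder.Language.{u, v}}

/-- The free first-order variables. -/
def freeVars : Formula L → Finset ℕ
  | rel _ x => Finset.univ.image x
  | fixvar _ x => {x}
  | eq x y => {x, y}
  | and φ ψ => φ.freeVars ∪ ψ.freeVars
  | or φ ψ => φ.freeVars ∪ ψ.freeVars
  | ex x φ => φ.freeVars.erase x
  | neg φ => φ.freeVars
  | lfp _ x φ y => insert y (φ.freeVars.erase x)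

/-- All first-order variables that are used, free or bound. -/
def vars : Formula L → Finset ℕ
  | rel _ x => Finset.univ.image x
  | fixvar _ x => {x}
  | eq x y => {x, y}
  | and φ ψ => φ.vars ∪ ψ.vars
  | or φ ψ => φ.vars ∪ ψ.vars
  | ex x φ => insert x φ.vars
  | neg φ => φ.vars
  | lfp _ x φ y => insert x (insert y φ.vars)

/-- With `pos = true` (`pos = false`): every free occurrence of the fixpoint variable `X` lies
under an even (odd) number of negations. -/
def OccursOnly (X : ℕ) : Bool → Formula L → Prop
  | _, rel _ _ => True
  | pos, fixvar Y _ => Y = X → pos = true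
  | _, eq _ _ => True
  | pos, and φ ψ => φ.OccursOnly X pos ∧ ψ.OccursOnly X pos
  | pos, or φ ψ => φ.OccursOnly X pos ∧ ψ.OccursOnly X pos
  | pos, ex _ φ => φ.OccursOnly X pos
  | pos, neg φ => φ.OccursOnly X (!pos)
  | pos, lfp Y _ φ _ => Y = X ∨ φ.OccursOnly X pos

/-- The unary-negation fixpoint logic: only formulas with at most one free first-order variable
are negated, and in `[LFP_{X,x} φ](y)` the variable `X` occurs only positively in `φ` and `φ` has
no free first-order variable besides (possibly) `x`. -/
def IsUNFP : Formula L → Prop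
  | rel _ _ => True
  | fixvar _ _ => True
  | eq _ _ => True
  | and φ ψ => φ.IsUNFP ∧ ψ.IsUNFP
  | or φ ψ => φ.IsUNFP ∧ ψ.IsUNFP
  | ex _ φ => φ.IsUNFP
  | neg φ => φ.IsUNFP ∧ φ.freeVars.card ≤ 1
  | lfp X x φ _ => φ.IsUNFP ∧ φ.OccursOnly X true ∧ φ.freeVars ⊆ {x}

/-- Satisfaction in the structure `M`, where `S` interprets the fixpoint variables and `a` the
first-order variables. The least fixpoint is the intersection of all pre-fixed points. -/
def Realize {M : Type w} [L.Structure M] : (ℕ → Set M) → (ℕ → M) → Formula L → Prop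
  | _, a, rel R x => FirstOrder.Language.Structure.RelMap R (fun i => a (x i))
  | S, a, fixvar X x => a x ∈ S X
  | _, a, eq x y => a x = a y
  | S, a, and φ ψ => φ.Realize S a ∧ ψ.Realize S a
  | S, a, or φ ψ => φ.Realize S a ∨ ψ.Realize S a
  | S, a, ex x φ => ∃ b : M, φ.Realize S (Function.update a x b)
  | S, a, neg φ => ¬ φ.Realize S a
  | S, a, lfp X x φ y =>
      a y ∈ ⋂₀ {A : Set M |
        {b : M | φ.Realize (Function.update S X A) (Function.update a x b)} ⊆ A}

/-- `φ` is true in some structure with universe in `Type w`, for some interpretation of its free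
variables. (The structure is nonempty, since an assignment exists.) -/
def Satisfiable (φ : Formula L) : Prop :=
  ∃ (M : Type w) (_ : L.Structure M) (S : ℕ → Set M) (a : ℕ → M), φ.Realize S a

/-- Replace the free occurrences of `x` by `y`; only used when `y` does not occur at all. -/
def subst (x y : ℕ) : Formula L → Formula L
  | rel R z => rel R (fun i => if z i = x then y else z i)
  | fixvar X z => fixvar X (if z = x then y else z)
  | eq z z' => eq (if z = x then y else z) (if z' = x then y else z')
  | and φ ψ => and (φ.subst x y) (ψ.subst x y)
  | or φ ψ => or (φ.subst x y) (ψ.subst x y)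
  | ex z φ => if z = x then ex z φ else ex z (φ.subst x y)
  | neg φ => neg (φ.subst x y)
  | lfp X z φ z' =>
      lfp X z (if z = x then φ else φ.subst x y) (if z' = x then y else z')

/-- One rewrite step: an existential quantifier is pulled out of a conjunction or a disjunction
(from either side), or a bound first-order variable is renamed to one that does not occur in its
scope; a step may be applied to any subformula. -/
inductive Step : Formula L → Formula L → Prop
  | pull_and_right {φ ψ : Formula L} {x : ℕ} (h : x ∉ φ.freeVars) :
      Step (and φ (ex x ψ)) (ex x (and φ ψ))
  | pull_and_left {φ ψ : Formula L} {x : ℕ} (h : x ∉ ψ.freeVars) :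
      Step (and (ex x φ) ψ) (ex x (and φ ψ))
  | pull_or_right {φ ψ : Formula L} {x : ℕ} (h : x ∉ φ.freeVars) :
      Step (or φ (ex x ψ)) (ex x (or φ ψ))
  | pull_or_left {φ ψ : Formula L} {x : ℕ} (h : x ∉ ψ.freeVars) :
      Step (or (ex x φ) ψ) (ex x (or φ ψ))
  | rename_ex {φ : Formula L} {x y : ℕ} (h : y ∉ φ.vars) :
      Step (ex x φ) (ex y (φ.subst x y))
  | rename_lfp {φ : Formula L} {X x y z : ℕ} (h : y ∉ φ.vars) :
      Step (lfp X x φ z) (lfp X y (φ.subst x y) z)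
  | and_left {φ φ' ψ : Formula L} (h : Step φ φ') : Step (and φ ψ) (and φ' ψ)
  | and_right {φ ψ ψ' : Formula L} (h : Step ψ ψ') : Step (and φ ψ) (and φ ψ')
  | or_left {φ φ' ψ : Formula L} (h : Step φ φ') : Step (or φ ψ) (or φ' ψ)
  | or_right {φ ψ ψ' : Formula L} (h : Step ψ ψ') : Step (or φ ψ) (or φ ψ')
  | ex {φ φ' : Formula L} {x : ℕ} (h : Step φ φ') : Step (Formula.ex x φ) (Formula.ex x φ')
  | neg {φ φ' : Formula L} (h : Step φ φ') : Step (Formula.neg φ) (Formula.neg φ')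
  | lfp {φ φ' : Formula L} {X x y : ℕ} (h : Step φ φ') :
      Step (Formula.lfp X x φ y) (Formula.lfp X x φ' y)

/-- Every existential quantifier is directly below another one, or starts a subformula with at most
one free first-order variable; the flag exempts the quantifier at the head of the formula. -/
def IsUNNormalAux : Bool → Formula L → Prop
  | _, rel _ _ => True
  | _, fixvar _ _ => True
  | _, eq _ _ => True
  | _, and φ ψ => φ.IsUNNormalAux false ∧ ψ.IsUNNormalAux false
  | _, or φ ψ => φ.IsUNNormalAux false ∧ ψ.IsUNNormalAux false
  | exempt, ex x φ =>
      (exempt = true ∨ (Formula.ex x φ).freeVars.card ≤ 1) ∧ φ.IsUNNormalAux true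
  | _, neg φ => φ.IsUNNormalAux false
  | _, lfp _ _ φ _ => φ.IsUNNormalAux false

/-- UN-normal form: in the syntax tree, every existential quantifier other than the root is directly
below another existential quantifier, or starts a subformula with at most one free first-order
variable. -/
def IsUNNormal (φ : Formula L) : Prop := φ.IsUNNormalAux true

/-- `φ` has width `k`: it can be rewritten into a formula in UN-normal form that uses at most `k`
first-order variables. -/
def HasWidth (φ : Formula L) (k : ℕ) : Prop :=
  ∃ ψ : Formula L, Relation.ReflTransGen Step φ ψ ∧ ψ.IsUNNormal ∧ ψ.vars.card ≤ k

end Formula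

/-- A tree decomposition of the structure `M`: a (possibly infinite) tree with a bag of elements
at each node, such that each element lies in some bag, the elements of each fact
lie together in some bag, and the nodes whose bags contain a given element are connected in the
tree. -/
structure TreeDecomposition (L : FirstOrder.Language.{u, v}) (M : Type w) [L.Structure M] where
  Node : Type w
  tree : SimpleGraph Node
  isTree : tree.IsTree
  bag : Node → Set M
  exists_mem_bag : ∀ a : M, ∃ t, a ∈ bag t
  fact_subset_bag : ∀ {n : ℕ} (R : L.Relations n) (x : Fin n → M),
    FirstOrder.Language.Structure.RelMap R x → ∃ t, Set.range x ⊆ bag t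
  bag_connected : ∀ a : M, (tree.induce {t | a ∈ bag t}).Connected

/-- `M` has tree-width at most `m`: it has a tree decomposition in which each bag has at most
`m + 1` elements. -/
def HasTreeWidthAtMost (L : FirstOrder.Language.{u, v}) (M : Type w) [L.Structure M] (m : ℕ) : Prop :=
  ∃ D : TreeDecomposition L M, ∀ t, (D.bag t).encard ≤ m + 1

end UNFP

namespace UNFP

/-! ### Syntax, semantics and rewriting of formulas -/

namespace Formula

variable {L : FirstOrder.Language.{u, v}}

/-! Rewriting preserves truth and the UNFP conditions, so it suffices to treat a formula in
UN-normal form with at most `m + 1 = k` variables that is true in some `M`. Unravel `M`: below an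
empty root hangs a copy of every `m + 1`-tuple, and every element `p` of the unravelling gets an
attached copy of every `m`-tuple, in a bag together with `p`. Only facts of `M` whose copies share a
bag are kept, so the tree-width bound is built in and the projection to `M` is a homomorphism.

Truth transfers by a simultaneous induction (`realize_unravelling`). From the unravelling to `M` it
passes along the projection. Back from `M` it lifts to local assignments: the values lie in one bag,
as relational atoms require, and distinct values have distinct projections, as equalities require (a
copied tuple may repeat entries). Negated formulas and fixpoint bodies have at most one free
variable, so every assignment is local for them. A quantifier block with at most one free variable
involves at most `m + 1` values, which lift to a bag through the prescribed element
(`exists_isLocal`). Fixpoints transfer by `realize_lfp_iff`. -/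

theorem freeVars_subset_vars (φ : Formula L) : φ.freeVars ⊆ φ.vars := by
  induction φ with
  | rel R x => exact subset_rfl
  | fixvar X x => exact subset_rfl
  | eq x y => exact subset_rfl
  | and φ ψ hφ hψ => exact Finset.union_subset_union hφ hψ
  | or φ ψ hφ hψ => exact Finset.union_subset_union hφ hψ
  | ex x φ h => exact ((Finset.erase_subset _ _).trans h).trans (Finset.subset_insert _ _)
  | neg φ h => exact h
  | lfp X x φ y h =>
    simp only [freeVars, vars]
    intro z
    have := @h z
    simp only [Finset.mem_insert, Finset.mem_erase]
    tauto

section Semantics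

variable {M : Type w} [L.Structure M]

theorem realize_congr (φ : Formula L) {S : ℕ → Set M} {a b : ℕ → M}
    (h : ∀ x ∈ φ.freeVars, a x = b x) : φ.Realize S a ↔ φ.Realize S b := by
  induction φ generalizing S a b with
  | rel R x =>
    have : (fun i => a (x i)) = fun i => b (x i) :=
      funext fun i => h _ (by simp [freeVars])
    simp only [Realize, this]
  | fixvar X x => simp only [Realize, h x (by simp [freeVars])]
  | eq x y => simp only [Realize, h x (by simp [freeVars]), h y (by simp [freeVars])]
  | and φ ψ hφ hψ =>
    simp only [freeVars, Finset.mem_union] at h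
    simp only [Realize, hφ fun x hx => h x (.inl hx), hψ fun x hx => h x (.inr hx)]
  | or φ ψ hφ hψ =>
    simp only [freeVars, Finset.mem_union] at h
    simp only [Realize, hφ fun x hx => h x (.inl hx), hψ fun x hx => h x (.inr hx)]
  | ex x φ hφ =>
    simp only [freeVars, Finset.mem_erase] at h
    refine exists_congr fun c => hφ fun y hy => ?_
    by_cases hyx : y = x
    · subst hyx; simp
    · simp [hyx, h y ⟨hyx, hy⟩]
  | neg φ hφ => exact not_congr (hφ h)
  | lfp X x φ y hφ =>
    simp only [freeVars, Finset.mem_insert, Finset.mem_erase] at h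
    have (A : Set M) (c : M) : φ.Realize (Function.update S X A) (Function.update a x c) ↔
        φ.Realize (Function.update S X A) (Function.update b x c) := hφ fun z hz => by
      by_cases hzx : z = x
      · subst hzx; simp
      · simp [hzx, h z (.inr ⟨hzx, hz⟩)]
    simp only [Realize, h y (.inl rfl), this]

theorem realize_update_of_notMem (φ : Formula L) {S : ℕ → Set M} {a : ℕ → M} {x : ℕ} (b : M)
    (h : x ∉ φ.freeVars) : φ.Realize S (Function.update a x b) ↔ φ.Realize S a :=
  φ.realize_congr fun y hy => Function.update_of_ne (by rintro rfl; exact h hy) _ _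

/-- Truth is monotone in positive and antitone in negative fixpoint variables. -/
theorem realize_mono (φ : Formula L) {X : ℕ} {A B : Set M} (hAB : A ⊆ B) :
    ∀ {S : ℕ → Set M} {a : ℕ → M},
    (φ.OccursOnly X true → φ.Realize (Function.update S X A) a →
      φ.Realize (Function.update S X B) a) ∧
    (φ.OccursOnly X false → φ.Realize (Function.update S X B) a →
      φ.Realize (Function.update S X A) a) := by
  induction φ with
  | rel R x => exact ⟨fun _ h => h, fun _ h => h⟩
  | eq x y => exact ⟨fun _ h => h, fun _ h => h⟩
  | fixvar Y x =>
    intro S a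
    by_cases hY : Y = X
    · subst hY
      simp only [Realize, OccursOnly, Function.update_self]
      exact ⟨fun _ h => hAB h, by simp⟩
    · simp [Realize, hY]
  | and φ ψ hφ hψ =>
    exact ⟨fun h h' => ⟨hφ.1 h.1 h'.1, hψ.1 h.2 h'.2⟩,
      fun h h' => ⟨hφ.2 h.1 h'.1, hψ.2 h.2 h'.2⟩⟩
  | or φ ψ hφ hψ =>
    exact ⟨fun h h' => h'.imp (hφ.1 h.1) (hψ.1 h.2), fun h h' => h'.imp (hφ.2 h.1) (hψ.2 h.2)⟩
  | ex x φ hφ => exact ⟨fun h ⟨b, hb⟩ => ⟨b, hφ.1 h hb⟩, fun h ⟨b, hb⟩ => ⟨b, hφ.2 h hb⟩⟩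
  | neg φ hφ => exact ⟨fun h h' h'' => h' (hφ.2 h h''), fun h h' h'' => h' (hφ.1 h h'')⟩
  | lfp Y x φ y hφ =>
    intro S a
    by_cases hY : Y = X
    -- The inner binder overwrites the value of the fixpoint variable, so both sides coincide.
    · subst hY
      simp [Realize]
    · simp only [OccursOnly, hY, false_or, Realize, Set.mem_sInter, Set.mem_ofPred_eq]
      have comm (C D : Set M) : Function.update (Function.update S X C) Y D =
          Function.update (Function.update S Y D) X C := Function.update_comm (Ne.symm hY) _ _ _
      simp only [comm]
      exact ⟨fun h h' D hD => h' D fun b hb => hD (hφ.1 h hb),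
        fun h h' D hD => h' D fun b hb => hD (hφ.2 h hb)⟩

end Semantics

/-! ### Substitution of a fresh variable -/

section Subst

/-- Freshness of `y` excludes capture. Being an image, the new set is no larger, so negations stay
unary under renaming. -/
theorem freeVars_subst {φ : Formula L} {x y : ℕ} (h : y ∉ φ.vars) :
    (φ.subst x y).freeVars = φ.freeVars.image fun z => if z = x then y else z := by
  induction φ with
  | rel R z => simp only [subst, freeVars, Finset.image_image]; rfl
  | fixvar X z => simp [subst, freeVars]
  | eq z z' => simp [subst, freeVars, Finset.image_insert]
  | and φ ψ hφ hψ =>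
    simp only [vars, Finset.mem_union, not_or] at h
    simp only [subst, freeVars, hφ h.1, hψ h.2, Finset.image_union]
  | or φ ψ hφ hψ =>
    simp only [vars, Finset.mem_union, not_or] at h
    simp only [subst, freeVars, hφ h.1, hψ h.2, Finset.image_union]
  | neg φ hφ => exact hφ h
  | ex z φ hφ =>
    simp only [vars, Finset.mem_insert, not_or] at h
    have hy := fun h' => h.2 (φ.freeVars_subset_vars h')
    specialize hφ h.2
    by_cases hz : z = x
    · ext c
      simp only [subst, if_pos hz, freeVars, Finset.mem_image, Finset.mem_erase]
      grind
    · ext c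
      simp only [subst, if_neg hz, freeVars, hφ, Finset.mem_image, Finset.mem_erase]
      grind
  | lfp X z φ z' hφ =>
    simp only [vars, Finset.mem_insert, not_or] at h
    have hy := fun h' => h.2.2 (φ.freeVars_subset_vars h')
    specialize hφ h.2.2
    by_cases hz : z = x
    · ext c
      simp only [subst, if_pos hz, freeVars, Finset.mem_image, Finset.mem_erase,
        Finset.mem_insert]
      grind
    · ext c
      simp only [subst, if_neg hz, freeVars, hφ, Finset.mem_image, Finset.mem_erase,
        Finset.mem_insert]
      grind

theorem occursOnly_subst {φ : Formula L} {X x y : ℕ} {pos : Bool} (h : φ.OccursOnly X pos) :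
    (φ.subst x y).OccursOnly X pos := by
  induction φ generalizing pos with
  | rel R z => trivial
  | fixvar Y z => exact h
  | eq z z' => trivial
  | and φ ψ hφ hψ => exact ⟨hφ h.1, hψ h.2⟩
  | or φ ψ hφ hψ => exact ⟨hφ h.1, hψ h.2⟩
  | neg φ hφ => exact hφ (pos := !pos) h
  | ex z φ hφ =>
    simp only [subst]
    split_ifs
    · exact h
    · exact hφ (pos := pos) h
  | lfp Y z φ z' hφ =>
    refine h.imp id fun h => ?_
    split_ifs
    · exact h
    · exact hφ h

theorem isUNFP_subst {φ : Formula L} {x y : ℕ} (hy : y ∉ φ.vars) (h : φ.IsUNFP) :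
    (φ.subst x y).IsUNFP := by
  induction φ with
  | rel R z => trivial
  | fixvar Y z => trivial
  | eq z z' => trivial
  | and φ ψ hφ hψ =>
    simp only [vars, Finset.mem_union, not_or] at hy
    exact ⟨hφ hy.1 h.1, hψ hy.2 h.2⟩
  | or φ ψ hφ hψ =>
    simp only [vars, Finset.mem_union, not_or] at hy
    exact ⟨hφ hy.1 h.1, hψ hy.2 h.2⟩
  | neg φ hφ =>
    refine ⟨hφ hy h.1, ?_⟩
    rw [freeVars_subst (φ := φ) hy]
    exact Finset.card_image_le.trans h.2
  | ex z φ hφ =>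
    simp only [vars, Finset.mem_insert, not_or] at hy
    simp only [subst]
    split_ifs
    · exact h
    · exact hφ hy.2 h
  | lfp X z φ z' hφ =>
    simp only [vars, Finset.mem_insert, not_or] at hy
    by_cases hz : z = x
    · simp only [subst, if_pos hz]
      exact h
    · simp only [subst, if_neg hz]
      refine ⟨hφ hy.2.2 h.1, occursOnly_subst h.2.1, ?_⟩
      rw [freeVars_subst hy.2.2]
      have := h.2.2
      intro c
      simp only [Finset.mem_image]
      grind

theorem realize_subst {M : Type w} [L.Structure M] {φ : Formula L} {x y : ℕ} (h : y ∉ φ.vars)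
    {S : ℕ → Set M} {a : ℕ → M} :
    (φ.subst x y).Realize S a ↔ φ.Realize S (Function.update a x (a y)) := by
  have key (z : ℕ) (a : ℕ → M) :
      a (if z = x then y else z) = Function.update a x (a y) z := by
    by_cases hz : z = x <;> simp [hz]
  induction φ generalizing S a with
  | rel R z => simp only [subst, Realize, key]
  | fixvar X z => simp only [subst, Realize, key]
  | eq z z' => simp only [subst, Realize, key]
  | and φ ψ hφ hψ =>
    simp only [vars, Finset.mem_union, not_or] at h
    exact and_congr (hφ h.1) (hψ h.2)
  | or φ ψ hφ hψ =>
    simp only [vars, Finset.mem_union, not_or] at h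
    exact or_congr (hφ h.1) (hψ h.2)
  | neg φ hφ => exact not_congr (hφ h)
  | ex z φ hφ =>
    simp only [vars, Finset.mem_insert, not_or] at h
    by_cases hz : z = x
    · subst hz
      simp [subst, Realize]
    · simp only [subst, if_neg hz, Realize, hφ h.2, Function.update_of_ne h.1,
        Function.update_comm hz]
  | lfp X z φ z' hφ =>
    simp only [vars, Finset.mem_insert, not_or] at h
    by_cases hz : z = x
    · subst hz
      simp only [subst, if_true, Realize, key, Function.update_idem]
    · simp only [subst, if_neg hz, Realize, key, hφ h.2.2, Function.update_of_ne h.1,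
        Function.update_comm hz]

end Subst

/-! ### Invariance under rewriting -/

namespace Step

variable {φ ψ : Formula L}

/-- Needed for steps below a negation or a fixpoint operator, whose side conditions refer to the
free variables of the body. -/
theorem freeVars_eq (h : Step φ ψ) : φ.freeVars = ψ.freeVars := by
  induction h with
  | pull_and_right h => simp only [freeVars, Finset.erase_union_distrib, Finset.erase_eq_of_notMem h]
  | pull_and_left h => simp only [freeVars, Finset.erase_union_distrib, Finset.erase_eq_of_notMem h]
  | pull_or_right h => simp only [freeVars, Finset.erase_union_distrib, Finset.erase_eq_of_notMem h]
  | pull_or_left h => simp only [freeVars, Finset.erase_union_distrib, Finset.erase_eq_of_notMem h]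
  | @rename_ex φ x y h =>
    have hy := fun h' => h (φ.freeVars_subset_vars h')
    ext c
    simp only [freeVars, freeVars_subst h, Finset.mem_erase, Finset.mem_image]
    grind
  | @rename_lfp φ X x y z h =>
    have hy := fun h' => h (φ.freeVars_subset_vars h')
    ext c
    simp only [freeVars, freeVars_subst h, Finset.mem_erase, Finset.mem_image, Finset.mem_insert]
    grind
  | and_left _ ih => simp only [freeVars, ih]
  | and_right _ ih => simp only [freeVars, ih]
  | or_left _ ih => simp only [freeVars, ih]
  | or_right _ ih => simp only [freeVars, ih]
  | ex _ ih => simp only [freeVars, ih]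
  | neg _ ih => simp only [freeVars, ih]
  | lfp _ ih => simp only [freeVars, ih]

theorem occursOnly (h : Step φ ψ) {X : ℕ} {pos : Bool} (hφ : φ.OccursOnly X pos) :
    ψ.OccursOnly X pos := by
  induction h generalizing pos with
  | pull_and_right h => exact hφ
  | pull_and_left h => exact hφ
  | pull_or_right h => exact hφ
  | pull_or_left h => exact hφ
  | rename_ex h => exact occursOnly_subst (pos := pos) hφ
  | rename_lfp h => exact hφ.imp id occursOnly_subst
  | and_left _ ih => exact hφ.imp ih id
  | and_right _ ih => exact hφ.imp id ih
  | or_left _ ih => exact hφ.imp ih id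
  | or_right _ ih => exact hφ.imp id ih
  | ex _ ih => exact ih (pos := pos) hφ
  | neg _ ih => exact ih (pos := !pos) hφ
  | lfp _ ih => exact hφ.imp id ih

theorem isUNFP (h : Step φ ψ) (hφ : φ.IsUNFP) : ψ.IsUNFP := by
  induction h with
  | pull_and_right h => exact hφ
  | pull_and_left h => exact hφ
  | pull_or_right h => exact hφ
  | pull_or_left h => exact hφ
  | rename_ex h => exact isUNFP_subst h hφ
  | @rename_lfp φ X x y z h =>
    refine ⟨isUNFP_subst h hφ.1, occursOnly_subst hφ.2.1, ?_⟩
    rw [freeVars_subst h]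
    have := hφ.2.2
    intro c
    simp only [Finset.mem_image]
    grind
  | and_left _ ih => exact hφ.imp ih id
  | and_right _ ih => exact hφ.imp id ih
  | or_left _ ih => exact hφ.imp ih id
  | or_right _ ih => exact hφ.imp id ih
  | ex _ ih => exact ih hφ
  | neg h ih => exact ⟨ih hφ.1, h.freeVars_eq ▸ hφ.2⟩
  | lfp h ih => exact ⟨ih hφ.1, h.occursOnly hφ.2.1, h.freeVars_eq ▸ hφ.2.2⟩

theorem realize_iff {M : Type w} [L.Structure M] (h : Step φ ψ) {S : ℕ → Set M} {a : ℕ → M} :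
    φ.Realize S a ↔ ψ.Realize S a := by
  -- Pulling a quantifier out of a disjunction is sound only over a nonempty domain.
  have : Nonempty M := ⟨a 0⟩
  induction h generalizing S a with
  | pull_and_right h => simp only [Realize, realize_update_of_notMem _ _ h, exists_and_left]
  | pull_and_left h => simp only [Realize, realize_update_of_notMem _ _ h, exists_and_right]
  | pull_or_right h => simp only [Realize, realize_update_of_notMem _ _ h, exists_or, exists_const]
  | pull_or_left h => simp only [Realize, realize_update_of_notMem _ _ h, exists_or, exists_const]
  | @rename_ex φ x y h =>
    refine exists_congr fun b => ?_
    rw [realize_subst h]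
    refine realize_congr _ fun z hz => ?_
    have hzy : z ≠ y := by rintro rfl; exact h (φ.freeVars_subset_vars hz)
    by_cases hzx : z = x
    · subst hzx; simp
    · simp [hzx, hzy]
  | @rename_lfp φ X x y z h =>
    have (A : Set M) (b : M) :
        (φ.subst x y).Realize (Function.update S X A) (Function.update a y b) ↔
          φ.Realize (Function.update S X A) (Function.update a x b) := by
      rw [realize_subst h]
      refine realize_congr _ fun z hz => ?_
      have hzy : z ≠ y := by rintro rfl; exact h (φ.freeVars_subset_vars hz)
      by_cases hzx : z = x
      · subst hzx; simp
      · simp [hzx, hzy]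
    simp only [Realize, this]
  | and_left _ ih => simp only [Realize, ih]
  | and_right _ ih => simp only [Realize, ih]
  | or_left _ ih => simp only [Realize, ih]
  | or_right _ ih => simp only [Realize, ih]
  | ex _ ih => simp only [Realize, ih]
  | neg _ ih => simp only [Realize, ih]
  | lfp _ ih => simp only [Realize, ih]

end Step

theorem IsUNNormalAux.mono {φ : Formula L} (h : φ.IsUNNormalAux false) : φ.IsUNNormalAux true := by
  cases φ <;> simp_all [IsUNNormalAux]

end Formula

/-! ### Trees from parent functions -/

/-- The graph of a parent function that decreases some rank and has a single root is a tree. -/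
theorem isTree_fromRel_parent {V : Type*} (parent : V → Option V) (depth : V → ℕ) (r : V)
    (hdepth : ∀ s t, parent s = some t → depth t < depth s) (hroot : ∀ s, parent s = none → s = r) :
    (SimpleGraph.fromRel fun s t => parent s = some t).IsTree := by
  set G := SimpleGraph.fromRel fun s t => parent s = some t
  have adj_iff {s t : V} : G.Adj s t ↔ parent s = some t ∨ parent t = some s := by
    rw [SimpleGraph.fromRel_adj, and_iff_right_iff_imp]
    rintro (h | h) rfl <;> exact (hdepth _ _ h).false
  have bridge {s t : V} (hst : parent s = some t) : G.IsBridge s(s, t) := by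
    rw [SimpleGraph.isBridge_iff]
    rintro ⟨p⟩
    -- The descendants of `s` can be left only through the edge to its parent `t`. They all have
    -- depth at least that of `s`, so `t` is not among them.
    let D : V → Prop := fun c => Relation.ReflTransGen (fun a b => parent a = some b) c s
    have walk {a b : V} (p : (G.deleteEdges {s(s, t)}).Walk a b) : D a → D b := by
      induction p with
      | nil => exact id
      | @cons a b c hab _ ih =>
        refine fun ha => ih ?_
        rw [SimpleGraph.deleteEdges_adj, adj_iff] at hab
        obtain ⟨hab | hab, hne⟩ := hab
        · rcases ha.cases_head with rfl | ⟨d, had, hd⟩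
          · obtain rfl : t = b := by simpa [hst] using hab
            simp at hne
          · obtain rfl : d = b := by simpa [had] using hab
            exact hd
        · exact .head hab ha
    have rank {c : V} (h : D c) : depth s ≤ depth c := by
      induction h using Relation.ReflTransGen.head_induction_on with
      | refl => rfl
      | head h _ ih => exact ih.trans (hdepth _ _ h).le
    exact (hdepth _ _ hst).not_ge (rank (walk p .refl))
  have reach (n : ℕ) (s : V) (hn : depth s = n) : G.Reachable s r := by
    induction n using Nat.strong_induction_on generalizing s with
    | _ n ih =>
      cases h : parent s with
      | none => rw [hroot s h]
      | some t =>
        exact (adj_iff.2 (.inl h)).reachable.trans (ih _ (hn ▸ hdepth _ _ h) t rfl)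
  have : Nonempty V := ⟨r⟩
  refine ⟨⟨fun s t => (reach _ s rfl).trans (reach _ t rfl).symm⟩, ?_⟩
  rw [SimpleGraph.isAcyclic_iff_forall_adj_isBridge]
  intro s t hst
  rcases adj_iff.1 hst with h | h
  · exact bridge h
  · rw [Sym2.eq_swap]
    exact bridge h

/-! ### The unravelling and its tree decomposition -/

/-- The elements of the tree unravelling of `M` into copies of tuples: the entries of a copy of an
`m + 1`-tuple, and the entries of a copy of an `m`-tuple that is attached to an element. -/
inductive Unravelling (m : ℕ) (M : Type w) : Type w
  | free (f : Fin (m + 1) → M) (i : Fin (m + 1)) : Unravelling m M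
  | attached (p : Unravelling m M) (f : Fin m → M) (i : Fin m) : Unravelling m M

namespace Unravelling

variable {m : ℕ} {M : Type w}

/-- The element of `M` that an element of the unravelling is a copy of. -/
def proj : Unravelling m M → M
  | free f i => f i
  | attached _ f i => f i

/-- The nodes of the tree decomposition of the unravelling. -/
inductive Node (m : ℕ) (M : Type w) : Type w
  | root : Node m M
  | free (f : Fin (m + 1) → M) : Node m M
  | attached (p : Unravelling m M) (f : Fin m → M) : Node m M

/-- The node at which an element is introduced. -/
def home : Unravelling m M → Node m M
  | free f _ => .free f
  | attached p f _ => .attached p f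

/-- The depth of the node at which an element is introduced. -/
def depth : Unravelling m M → ℕ
  | free _ _ => 1
  | attached p _ _ => p.depth + 1

namespace Node

/-- The elements at a node. -/
def bag : Node m M → Set (Unravelling m M)
  | root => ∅
  | free f => Set.range (Unravelling.free f)
  | attached p f => insert p (Set.range (Unravelling.attached p f))

/-- The parent of a node; an attached copy hangs below the node that introduces its anchor. -/
def parent : Node m M → Option (Node m M)
  | root => none
  | free _ => some root
  | attached p _ => some p.home

/-- The depth of a node. -/
def depth : Node m M → ℕ
  | root => 0
  | free _ => 1
  | attached p _ => p.depth + 1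

theorem encard_bag_le (t : Node m M) : t.bag.encard ≤ m + 1 := by
  have range_le {n : ℕ} (f : Fin n → Unravelling m M) : (Set.range f).encard ≤ n := by
    rw [← Set.image_univ]
    refine (Set.encard_image_le _ _).trans ?_
    simp
  cases t with
  | root => simp [bag]
  | free f => exact_mod_cast range_le (Unravelling.free f)
  | attached p f =>
    exact (Set.encard_insert_le _ _).trans (add_le_add_left (range_le _) _)

/-- The nodes containing `p` form a star: its home, and the copies attached to `p`, which are
children of that home. This gives connectedness. -/
theorem mem_bag_iff {p : Unravelling m M} {t : Node m M} :
    p ∈ t.bag ↔ t = p.home ∨ t.parent = some p.home ∧ ∃ f, t = attached p f := by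
  cases t with
  | root => cases p <;> simp [bag, home]
  | free f => cases p <;> simp [bag, home, eq_comm]
  | attached q f =>
    cases p with
    | free g i => simp [bag, home, parent]; grind [home]
    | attached p g i => simp [bag, home, parent]; grind [home]

end Node

theorem mem_bag_home (p : Unravelling m M) : p ∈ p.home.bag :=
  Node.mem_bag_iff.2 (.inl rfl)

theorem depth_home (p : Unravelling m M) : p.home.depth = p.depth := by
  cases p <;> rfl

variable {L : FirstOrder.Language.{u, v}} [L.IsRelational] [L.Structure M]

/-- The facts of the unravelling are the copies of facts of `M` within a bag. -/
instance : L.Structure (Unravelling m M) where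
  funMap F := isEmptyElim F
  RelMap R x := (∃ t : Node m M, Set.range x ⊆ t.bag) ∧
    FirstOrder.Language.Structure.RelMap R fun i => (x i).proj

/-- The tree decomposition of the unravelling. -/
def treeDecomposition : TreeDecomposition L (Unravelling m M) where
  Node := Node m M
  tree := SimpleGraph.fromRel fun s t => s.parent = some t
  isTree := by
    refine isTree_fromRel_parent Node.parent Node.depth .root ?_ ?_
    · rintro (_ | f | ⟨p, f⟩) t h <;> cases h
      · exact Nat.zero_lt_one
      · rw [depth_home]
        exact Nat.lt_succ_self _
    · rintro (_ | f | ⟨p, f⟩) h <;> cases h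
      rfl
  bag := Node.bag
  exists_mem_bag p := ⟨_, p.mem_bag_home⟩
  fact_subset_bag _ _ h := h.1
  bag_connected p := by
    have : Nonempty {t : Node m M | p ∈ t.bag} := ⟨⟨_, p.mem_bag_home⟩⟩
    have reach (t : {t : Node m M | p ∈ t.bag}) :
        ((SimpleGraph.fromRel fun s t : Node m M => s.parent = some t).induce
          {t : Node m M | p ∈ t.bag}).Reachable t ⟨_, p.mem_bag_home⟩ := by
      obtain ⟨t, ht⟩ := t
      by_cases hne : t = p.home
      · subst hne; rfl
      · obtain h | ⟨h, -⟩ := Node.mem_bag_iff.1 ht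
        · exact absurd h hne
        · refine SimpleGraph.Adj.reachable ?_
          rw [SimpleGraph.induce_adj, SimpleGraph.fromRel_adj]
          exact ⟨hne, .inl h⟩
    exact ⟨fun s t => (reach s).trans (reach t).symm⟩

theorem hasTreeWidthAtMost : HasTreeWidthAtMost L (Unravelling m M) m :=
  ⟨treeDecomposition, Node.encard_bag_le⟩

/-! ### Lifting assignments into a bag -/

section Lifting

theorem exists_subset_range [Nonempty M] {n : ℕ} (s : Finset M) (hs : s.card ≤ n) :
    ∃ f : Fin n → M, ∀ x ∈ s, ∃ i, f i = x := by
  obtain ⟨e⟩ : Nonempty (s ↪ Fin n) := Function.Embedding.nonempty_of_card_le (by simpa using hs)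
  exact ⟨Function.extend e Subtype.val fun _ => Classical.arbitrary M, fun x hx =>
    ⟨e ⟨x, hx⟩, e.injective.extend_apply _ _ _⟩⟩

/-- The assignment maps the variables in `W` into one bag, and the projection is injective on their
values. -/
def IsLocal (a : ℕ → Unravelling m M) (W : Finset ℕ) : Prop :=
  (∃ t : Node m M, ∀ x ∈ W, a x ∈ t.bag) ∧
    ∀ x ∈ W, ∀ y ∈ W, (a x).proj = (a y).proj → a x = a y

theorem IsLocal.mono {a : ℕ → Unravelling m M} {W W' : Finset ℕ} (h : IsLocal a W)
    (hW : W' ⊆ W) : IsLocal a W' :=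
  ⟨h.1.imp fun _ ht x hx => ht x (hW hx), fun x hx y hy => h.2 x (hW hx) y (hW hy)⟩

theorem isLocal_of_card_le_one (a : ℕ → Unravelling m M) {W : Finset ℕ} (hW : W.card ≤ 1) :
    IsLocal a W := by
  rw [Finset.card_le_one] at hW
  refine ⟨?_, fun x hx y hy _ => by rw [hW x hx y hy]⟩
  obtain rfl | ⟨x, hx⟩ := W.eq_empty_or_nonempty
  · exact ⟨.root, by simp⟩
  · exact ⟨(a x).home, fun y hy => hW x hx y hy ▸ mem_bag_home _⟩

/-- Up to `m + 1` elements of `M` lift to a common bag. -/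
theorem exists_lift [Nonempty M] (s : Finset M) (hs : s.card ≤ m + 1) :
    ∃ (t : Node m M) (q : M → Unravelling m M), ∀ x ∈ s, q x ∈ t.bag ∧ (q x).proj = x := by
  obtain ⟨f, hf⟩ := exists_subset_range s hs
  choose! i hi using hf
  exact ⟨.free f, fun x => .free f (i x), fun x hx => ⟨⟨_, rfl⟩, hi x hx⟩⟩

/-- Up to `m + 1` elements of `M` lift to a common bag so that one of them has a given lift. -/
theorem exists_lift_of_mem (p : Unravelling m M) (s : Finset M) (hs : s.card ≤ m + 1)
    (hp : p.proj ∈ s) : ∃ (t : Node m M) (q : M → Unravelling m M),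
      q p.proj = p ∧ ∀ x ∈ s, q x ∈ t.bag ∧ (q x).proj = x := by
  classical
  have : Nonempty M := ⟨p.proj⟩
  have : Nonempty (Unravelling m M) := ⟨p⟩
  -- The anchor `p` itself covers the value `p.proj`, so at most `m` values remain for the attached
  -- tuple.
  obtain ⟨f, hf⟩ := exists_subset_range (n := m) (s.erase p.proj) (by
    rw [Finset.card_erase_of_mem hp]; omega)
  have (x : M) (hx : x ∈ s) : ∃ q ∈ (Node.attached p f).bag, q.proj = x ∧ (x = p.proj → q = p) := by
    by_cases hxp : x = p.proj
    · exact ⟨p, .inl rfl, hxp.symm, fun _ => rfl⟩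
    · obtain ⟨i, hi⟩ := hf x (Finset.mem_erase.2 ⟨hxp, hx⟩)
      exact ⟨.attached p f i, .inr ⟨i, rfl⟩, hi, fun h => absurd h hxp⟩
  choose! q hq using this
  exact ⟨.attached p f, q, (hq _ hp).2.2 rfl, fun x hx => ⟨(hq x hx).1, (hq x hx).2.1⟩⟩

/-- An assignment in `M` lifts to a local assignment, with a prescribed value for one variable. -/
theorem exists_isLocal (V W : Finset ℕ) (hV : V.card ≤ m + 1) (hWV : W ⊆ V) (hW : W.card ≤ 1)
    (g : ℕ → M) (a : ℕ → Unravelling m M) (ha : ∀ x ∈ W, (a x).proj = g x) :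
    ∃ b : ℕ → Unravelling m M, (∀ x ∈ W, b x = a x) ∧ (∀ x ∈ V, (b x).proj = g x) ∧
      IsLocal b V := by
  classical
  have hcard : (V.image g).card ≤ m + 1 := Finset.card_image_le.trans hV
  have : Nonempty M := ⟨g 0⟩
  obtain ⟨t, q, hqW, hq⟩ : ∃ (t : Node m M) (q : M → Unravelling m M),
      (∀ x ∈ W, q (g x) = a x) ∧ ∀ x ∈ V.image g, q x ∈ t.bag ∧ (q x).proj = x := by
    obtain rfl | ⟨x, hx⟩ := W.eq_empty_or_nonempty
    · obtain ⟨t, q, hq⟩ := exists_lift (V.image g) hcard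
      exact ⟨t, q, by simp, hq⟩
    · obtain ⟨t, q, hqx, hq⟩ := exists_lift_of_mem (a x) (V.image g) hcard
        (ha x hx ▸ Finset.mem_image_of_mem g (hWV hx))
      refine ⟨t, q, fun y hy => ?_, hq⟩
      rw [Finset.card_le_one.1 hW y hy x hx, ← ha x hx, hqx]
  -- Lifts are chosen per value in `M`, not per variable, so variables with equal values get the
  -- same lift; this is the injectivity part of locality.
  refine ⟨fun x => q (g x), hqW, fun x hx => (hq _ (Finset.mem_image_of_mem g hx)).2,
    ⟨t, fun x hx => (hq _ (Finset.mem_image_of_mem g hx)).1⟩, fun x hx y hy h => ?_⟩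
  rw [(hq _ (Finset.mem_image_of_mem g hx)).2, (hq _ (Finset.mem_image_of_mem g hy)).2] at h
  exact congrArg q h

end Lifting

/-! ### Transfer of truth to the unravelling -/

/-- The interpretation of the fixpoint variables in the unravelling. -/
def pullback (m : ℕ) (S : ℕ → Set M) (X : ℕ) : Set (Unravelling m M) := proj ⁻¹' S X

theorem pullback_update (S : ℕ → Set M) (X : ℕ) (A : Set M) :
    pullback m (Function.update S X A) = Function.update (pullback m S) X (proj ⁻¹' A) := by
  funext Y
  by_cases h : Y = X
  · subst h; simp [pullback]
  · simp [pullback, h]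

open Formula

/-- If a body has the same truth value in `M` and the unravelling, then so has its least
fixpoint. -/
theorem realize_lfp_iff {φ : Formula L} {X x y : ℕ} (hpos : φ.OccursOnly X true)
    {S : ℕ → Set M} {a : ℕ → Unravelling m M}
    (h : ∀ (A : Set M) (b : Unravelling m M),
      φ.Realize (pullback m (Function.update S X A)) (Function.update a x b) ↔
        φ.Realize (Function.update S X A) (proj ∘ Function.update a x b)) :
    (lfp X x φ y).Realize (pullback m S) a ↔ (lfp X x φ y).Realize S (proj ∘ a) := by
  have h' (A : Set M) (b : Unravelling m M) :
      φ.Realize (Function.update (pullback m S) X (proj ⁻¹' A)) (Function.update a x b) ↔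
        φ.Realize (Function.update S X A) (Function.update (proj ∘ a) x b.proj) := by
    rw [← pullback_update, h, Function.comp_update]
  simp only [Realize, Set.mem_sInter, Set.mem_ofPred_eq]
  constructor
  · intro H A hA
    exact H (proj ⁻¹' A) fun b hb => hA ((h' A b).1 hb)
  · intro H A' hA'
    -- A pre-fixed point `A'` of the unravelling need not be a union of fibres. It is replaced by
    -- the set of those elements of `M` all of whose copies lie in `A'`; by positivity of `X` this
    -- set is a pre-fixed point in `M`.
    have hsub : (proj ⁻¹' {c : M | ∀ b : Unravelling m M, b.proj = c → b ∈ A'} :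
        Set (Unravelling m M)) ⊆ A' := fun b hb => hb b rfl
    refine hsub (H _ ?_)
    rintro c hc b rfl
    exact hA' ((φ.realize_mono hsub).1 hpos ((h' _ b).2 hc))

/-- Truth in the unravelling and truth in `M`: preservation under the projection, and under lifting
of single assignments and of the witnesses of a block of existential quantifiers. -/
theorem realize_unravelling {V : Finset ℕ} (hV : V.card ≤ m + 1) {φ : Formula L} (hφ : φ.IsUNFP)
    (hφV : φ.vars ⊆ V) :
    (φ.IsUNNormalAux true → ∀ (S : ℕ → Set M) (a : ℕ → Unravelling m M),
      φ.Realize (pullback m S) a → φ.Realize S (proj ∘ a)) ∧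
    (φ.IsUNNormalAux false → ∀ (S : ℕ → Set M) (a : ℕ → Unravelling m M),
      IsLocal a φ.freeVars → φ.Realize S (proj ∘ a) → φ.Realize (pullback m S) a) ∧
    (φ.IsUNNormalAux true → ∀ (S : ℕ → Set M) (g : ℕ → M), φ.Realize S g →
      ∃ g' : ℕ → M, (∀ x ∈ φ.freeVars, g' x = g x) ∧ ∀ a : ℕ → Unravelling m M,
        (∀ x ∈ V, (a x).proj = g' x) → IsLocal a V → φ.Realize (pullback m S) a) := by
  -- Without a leading quantifier there are no witnesses to record, so the third claim follows from
  -- the second with `g' = g`.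
  have block {φ : Formula L} (hφV : φ.vars ⊆ V)
      (h : ∀ (S : ℕ → Set M) (a : ℕ → Unravelling m M),
        IsLocal a φ.freeVars → φ.Realize S (proj ∘ a) → φ.Realize (pullback m S) a)
      (S : ℕ → Set M) (g : ℕ → M) (hg : φ.Realize S g) :
      ∃ g' : ℕ → M, (∀ x ∈ φ.freeVars, g' x = g x) ∧ ∀ a : ℕ → Unravelling m M,
        (∀ x ∈ V, (a x).proj = g' x) → IsLocal a V → φ.Realize (pullback m S) a := by
    have hfree := φ.freeVars_subset_vars.trans hφV
    exact ⟨g, fun _ _ => rfl, fun a hag ha => h S a (ha.mono hfree)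
      ((φ.realize_congr fun x hx => hag x (hfree hx)).2 hg)⟩
  induction φ with
  | rel R x =>
    have B (S : ℕ → Set M) (a : ℕ → Unravelling m M) (ha : IsLocal a (rel R x).freeVars)
        (h : (rel R x).Realize S (proj ∘ a)) : (rel R x).Realize (pullback m S) a := by
      obtain ⟨t, ht⟩ := ha.1
      refine ⟨⟨t, ?_⟩, h⟩
      rintro _ ⟨i, rfl⟩
      exact ht _ (by simp [freeVars])
    exact ⟨fun _ S a h => h.2, fun _ => B, fun _ => block hφV B⟩
  | fixvar X x =>
    have B (S : ℕ → Set M) (a : ℕ → Unravelling m M) (_ : IsLocal a (fixvar (L := L) X x).freeVars)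
        (h : (fixvar (L := L) X x).Realize S (proj ∘ a)) :
        (fixvar (L := L) X x).Realize (pullback m S) a := h
    exact ⟨fun _ S a h => h, fun _ => B, fun _ => block hφV B⟩
  | eq x y =>
    have B (S : ℕ → Set M) (a : ℕ → Unravelling m M) (ha : IsLocal a (eq (L := L) x y).freeVars)
        (h : (eq (L := L) x y).Realize S (proj ∘ a)) :
        (eq (L := L) x y).Realize (pullback m S) a :=
      ha.2 x (by simp [freeVars]) y (by simp [freeVars]) h
    exact ⟨fun _ S a h => congrArg proj h, fun _ => B, fun _ => block hφV B⟩
  | and φ ψ ihφ ihψ =>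
    obtain ⟨hφV', hψV'⟩ := Finset.union_subset_iff.1 hφV
    obtain ⟨Fφ, Bφ, -⟩ := ihφ hφ.1 hφV'
    obtain ⟨Fψ, Bψ, -⟩ := ihψ hφ.2 hψV'
    have B (hn : (and φ ψ).IsUNNormalAux false) (S : ℕ → Set M) (a : ℕ → Unravelling m M)
        (ha : IsLocal a (and φ ψ).freeVars)
        (h : (and φ ψ).Realize S (proj ∘ a)) : (and φ ψ).Realize (pullback m S) a :=
      ⟨Bφ hn.1 S a (ha.mono Finset.subset_union_left) h.1,
        Bψ hn.2 S a (ha.mono Finset.subset_union_right) h.2⟩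
    exact ⟨fun hn S a h => ⟨Fφ hn.1.mono S a h.1, Fψ hn.2.mono S a h.2⟩, B,
      fun hn => block hφV (B hn)⟩
  | or φ ψ ihφ ihψ =>
    obtain ⟨hφV', hψV'⟩ := Finset.union_subset_iff.1 hφV
    obtain ⟨Fφ, Bφ, -⟩ := ihφ hφ.1 hφV'
    obtain ⟨Fψ, Bψ, -⟩ := ihψ hφ.2 hψV'
    have B (hn : (or φ ψ).IsUNNormalAux false) (S : ℕ → Set M) (a : ℕ → Unravelling m M)
        (ha : IsLocal a (or φ ψ).freeVars)
        (h : (or φ ψ).Realize S (proj ∘ a)) : (or φ ψ).Realize (pullback m S) a :=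
      h.imp (Bφ hn.1 S a (ha.mono Finset.subset_union_left))
        (Bψ hn.2 S a (ha.mono Finset.subset_union_right))
    exact ⟨fun hn S a h => h.imp (Fφ hn.1.mono S a) (Fψ hn.2.mono S a), B,
      fun hn => block hφV (B hn)⟩
  | neg φ ih =>
    -- Negation exchanges the two directions; locality is automatic because at most one variable is
    -- free.
    obtain ⟨F, B, -⟩ := ih hφ.1 hφV
    have B' (hn : (neg φ).IsUNNormalAux false) (S : ℕ → Set M) (a : ℕ → Unravelling m M)
        (_ : IsLocal a (neg φ).freeVars)
        (h : (neg φ).Realize S (proj ∘ a)) : (neg φ).Realize (pullback m S) a :=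
      fun h' => h (F (IsUNNormalAux.mono hn) S a h')
    exact ⟨fun hn S a h h' => h (B hn S a (isLocal_of_card_le_one a hφ.2) h'), B',
      fun hn => block hφV (B' hn)⟩
  | ex x φ ih =>
    obtain ⟨F, -, Q⟩ := ih hφ ((Finset.subset_insert _ _).trans hφV)
    have hfree := (ex x φ).freeVars_subset_vars.trans hφV
    have Q' (hn : φ.IsUNNormalAux true) (S : ℕ → Set M) (g : ℕ → M)
        (hg : (ex x φ).Realize S g) :
        ∃ g' : ℕ → M, (∀ y ∈ (ex x φ).freeVars, g' y = g y) ∧ ∀ a : ℕ → Unravelling m M,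
          (∀ x ∈ V, (a x).proj = g' x) → IsLocal a V → (ex x φ).Realize (pullback m S) a := by
      obtain ⟨b, hb⟩ := hg
      obtain ⟨g', hg', H⟩ := Q hn S _ hb
      -- The values of `g'` on `V` already include witnesses for the whole block, so `a x` is the
      -- lifted witness and updating `a` at `x` by it changes nothing.
      refine ⟨g', fun y hy => ?_, fun a hag ha => ⟨a x, ?_⟩⟩
      · obtain ⟨hyx, hy⟩ := Finset.mem_erase.1 hy
        rw [hg' y hy, Function.update_of_ne hyx]
      · rw [Function.update_eq_self]
        exact H a hag ha
    refine ⟨fun hn S a ⟨b, hb⟩ => ⟨b.proj, ?_⟩, fun hn S a _ h => ?_, fun hn => Q' hn.2⟩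
    · rw [← Function.comp_update]
      exact F hn.2 S _ hb
    · obtain ⟨g', hg', H⟩ := Q' hn.2 S _ h
      -- UN-normal form leaves at most one free variable here. Its value under `a` is kept, while
      -- all other variables are lifted afresh into a bag around it.
      obtain ⟨b, hba, hbg, hb⟩ := exists_isLocal V (ex x φ).freeVars hV hfree
        (hn.1.resolve_left Bool.false_ne_true) g' a fun y hy => (hg' y hy).symm
      exact (realize_congr _ hba).1 (H b hbg hb)
  | lfp X x φ y ih =>
    obtain ⟨F, B, -⟩ := ih hφ.1 (((Finset.subset_insert _ _).trans
      (Finset.subset_insert _ _)).trans hφV)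
    have iff (hn : φ.IsUNNormalAux false) (S : ℕ → Set M) (a : ℕ → Unravelling m M) :
        (lfp X x φ y).Realize (pullback m S) a ↔ (lfp X x φ y).Realize S (proj ∘ a) :=
      realize_lfp_iff hφ.2.1 fun A b => ⟨F hn.mono _ _, B hn _ _
        (isLocal_of_card_le_one _ ((Finset.card_le_card hφ.2.2).trans (Finset.card_singleton x).le))⟩
    exact ⟨fun hn S a => (iff hn S a).1, fun hn S a _ => (iff hn S a).2,
      fun hn => block hφV fun S a _ => (iff hn S a).2⟩

/-- The unravelling satisfies every satisfied formula in UN-normal form with at most `m + 1`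
variables. -/
theorem exists_realize_unravelling {φ : Formula L} (hφ : φ.IsUNFP) (hn : φ.IsUNNormal)
    (hcard : φ.vars.card ≤ m + 1) {S : ℕ → Set M} {g : ℕ → M} (h : φ.Realize S g) :
    ∃ a : ℕ → Unravelling m M, φ.Realize (pullback m S) a := by
  obtain ⟨g', -, H⟩ := (realize_unravelling hcard hφ subset_rfl).2.2 hn S g h
  -- At the root no value is prescribed, so the assignment to be extended is arbitrary.
  obtain ⟨a, -, hag, ha⟩ := exists_isLocal φ.vars ∅ hcard (Finset.empty_subset _) (by simp) g'
    (fun _ => .free (fun _ => g 0) 0) (by simp)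
  exact ⟨a, H a hag ha⟩

end Unravelling

end UNFP

/-! ### The tree-width bound -/

theorem mainTheorem4 {L : FirstOrder.Language.{u, v}} [L.IsRelational]
    (k : ℕ) (hk : 1 ≤ k) (φ : UNFP.Formula L) (hφ : φ.IsUNFP) (hwidth : φ.HasWidth k)
    (hsat : UNFP.Formula.Satisfiable.{u, v, w} φ) :
    ∃ (M : Type w) (_ : L.Structure M) (S : ℕ → Set M) (a : ℕ → M),
      φ.Realize S a ∧ UNFP.HasTreeWidthAtMost L M (k - 1) := by
  obtain ⟨ψ, hsteps, hnormal, hcard⟩ := hwidth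
  obtain ⟨M, _, S, g, hg⟩ := hsat
  have hψ : ψ.IsUNFP := by
    clear hnormal hcard
    induction hsteps with
    | refl => exact hφ
    | tail _ h ih => exact h.isUNFP ih
  have realize_iff {N : Type w} [L.Structure N] (S : ℕ → Set N) (a : ℕ → N) :
      φ.Realize S a ↔ ψ.Realize S a := by
    clear hnormal hcard hψ
    induction hsteps with
    | refl => rfl
    | tail _ h ih => exact ih.trans h.realize_iff
  obtain ⟨a, ha⟩ := UNFP.Unravelling.exists_realize_unravelling (m := k - 1) hψ hnormal
    (by omega) ((realize_iff S g).1 hg)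
  exact ⟨_, inferInstance, _, a, (realize_iff _ _).2 ha, UNFP.Unravelling.hasTreeWidthAtMost⟩
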